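/- **Setting.** Let $(e_l)_{l\in\mathbb Z}$ be the canonical basis of $\ell^2(\mathbb Z)$ and write $\rho_{k,l}=\langle e_k,\rho e_l\rangle$ for a bounded operator $\rho$ on $\ell^2(\mathbb Z)$. A density operator is a positive semi-definite operator on $\ell^2(\mathbb Z)$ with trace one, and $\|A\|_{HS}=\big(\sum_{k,l}|A_{k,l}|^2\big)^{1/2}$ is the Hilbert–Schmidt norm. For $g\in\mathbb C\setminus\{0\}$ and $\theta\in[-\pi,\pi]$ let $U_\theta$ be the bounded operator on $\ell^2(\mathbb Z)$ with $$U_\theta e_l=\sum_{k\in\mathbb Z}e^{i(k-l)\theta}J_{k-l}(2|g|)\,e_k ,$$ where $J_n$ is the Bessel function of the first kind of order $n\in\mathbb Z$, and put $$(T\rho)(\theta,l)=\langle e_l,\,U_\theta\,\rho\,U_\theta^*e_l\rangle,\qquad (\theta,l)\in[-\pi,\pi]\times\mathbb Z .$$ Let $\|\cdot\|_2$ denote the norm of $L^2([-\pi,\pi]\times\mathbb Z)$ (Lebesgue measure times counting measure). For $0<b<1$ and $0<t<1$ let $\Phi(t)=\exp\!\big(\sqrt{(-\ln t)(-\ln b)}\big)$.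 **Theorem.** Let $0<b<1$. There is a constant $\tilde C>0$, depending only on $b$, such that for every $g\in\mathbb C\setminus\{0\}$, every $\alpha>\sqrt2$ and every $C>0$ there exist density operators $\rho,\sigma$ with $$\sum_{l\in\mathbb Z}|\rho_{l,l+k}|\le\tilde C\,b^{|k|},\qquad \sum_{l\in\mathbb Z}|\sigma_{l,l+k}|\le\tilde C\,b^{|k|}\qquad\text{for all }k\in\mathbb Z,$$ such that $0<\|T\sigma-T\rho\|_2<1$ and $$\|\sigma-\rho\|_{HS}\ \ge\ C\,\Phi\big(\|T\sigma-T\rho\|_2\big)^{-\alpha}.$$ -/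

import Mathlib

noncomputable section

namespace Pinem

open MeasureTheory Real

/-- The Hilbert space `ℓ²(ℤ)` of square-summable complex sequences. -/
abbrev L2Z : Type := lp (fun _ : ℤ => ℂ) 2

/-- The canonical basis vector `e_l` of `ℓ²(ℤ)`. -/
def e (l : ℤ) : L2Z := lp.single 2 l (1 : ℂ)

/-- The matrix entry `ρ_{k,l} = ⟨e_k, ρ e_l⟩` (the inner product is linear in the second slot). -/
def entry (ρ : L2Z →L[ℂ] L2Z) (k l : ℤ) : ℂ := inner ℂ (e k) (ρ (e l))

/-- Density operators: positive semi-definite (in particular self-adjoint) operators on `ℓ²(ℤ)`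
whose trace `∑ ⟨e_l, ρ e_l⟩` converges to `1`. -/
def IsDensity (ρ : L2Z →L[ℂ] L2Z) : Prop :=
  ρ.IsPositive ∧ HasSum (fun l : ℤ => entry ρ l l) 1

/-- The Hilbert-Schmidt norm, i.e. the `ℓ²(ℤ × ℤ)` norm of the matrix. -/
def hsNorm (ρ : L2Z →L[ℂ] L2Z) : ℝ :=
  √(∑' p : ℤ × ℤ, ‖entry ρ p.1 p.2‖ ^ 2)

/-- Exponentially decaying off-diagonals: every off-diagonal is absolutely summable and
`∑_l |ρ_{l,l+k}| ≤ c b^{|k|}` for all `k ∈ ℤ`. -/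
def HasExpDecay (b c : ℝ) (ρ : L2Z →L[ℂ] L2Z) : Prop :=
  ∀ k : ℤ, Summable (fun l : ℤ => ‖entry ρ l (l + k)‖) ∧
    ∑' l : ℤ, ‖entry ρ l (l + k)‖ ≤ c * b ^ k.natAbs

/-- The Bessel function of the first kind of integer order (Bessel's integral). -/
def besselJ (n : ℤ) (x : ℝ) : ℝ :=
  (1 / (2 * π)) * ∫ t in (-π)..π, Real.cos (n * t - x * Real.sin t)

lemma shift_memℓp (j : ℤ) (u : L2Z) : Memℓp (fun k : ℤ => (u : ∀ _ : ℤ, ℂ) (k - j)) 2 := by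
  have h := lp.memℓp u
  rw [memℓp_gen_iff (by norm_num)] at h ⊢
  exact ((Equiv.subRight j).summable_iff).2 h

/-- The shift `e_l ↦ e_{l+j}` of `ℓ²(ℤ)`, as a linear isometry. -/
def shiftIsometry (j : ℤ) : L2Z →ₗᵢ[ℂ] L2Z where
  toFun u := ⟨fun k : ℤ => (u : ∀ _ : ℤ, ℂ) (k - j), shift_memℓp j u⟩
  map_add' _ _ := rfl
  map_smul' _ _ := rfl
  norm_map' u := by
    rw [lp.norm_eq_tsum_rpow (by norm_num), lp.norm_eq_tsum_rpow (by norm_num)]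
    congr 1
    exact (Equiv.subRight j).tsum_eq (fun k => ‖(u : ∀ _ : ℤ, ℂ) k‖ ^ (2 : ENNReal).toReal)

/-- The shift `e_l ↦ e_{l+j}` of `ℓ²(ℤ)`. -/
def shift (j : ℤ) : L2Z →L[ℂ] L2Z := (shiftIsometry j).toContinuousLinearMap

lemma shift_e (j l : ℤ) : shift j (e l) = e (l + j) := by
  ext k
  change (e l : ∀ _ : ℤ, ℂ) (k - j) = (e (l + j) : ∀ _ : ℤ, ℂ) k
  simp only [e, lp.single_apply, Pi.single_apply]
  congr 1
  exact propext ⟨fun h => by omega, fun h => by omega⟩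

/-- The operator `U_θ = ∑_j e^{ijθ} J_j(2|g|) S_j` with `S_j` the shift by `j`; equivalently, the
bounded operator with `U_θ e_l = ∑_k e^{i(k-l)θ} J_{k-l}(2|g|) e_k`. -/
def U (g : ℂ) (θ : ℝ) : L2Z →L[ℂ] L2Z :=
  ∑' j : ℤ, (Complex.exp (Complex.I * (j * θ)) * (besselJ j (2 * ‖g‖) : ℂ)) • shift j

/-- The exponential whose Fourier coefficients are the Bessel functions. -/
def phase (x t : ℝ) : ℂ := Complex.exp (Complex.I * (x * Real.sin t : ℝ))

lemma continuous_phase (x : ℝ) : Continuous (phase x) := by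
  unfold phase; fun_prop

lemma norm_phase (x t : ℝ) : ‖phase x t‖ = 1 := by
  unfold phase; rw [mul_comm]; exact Complex.norm_exp_ofReal_mul_I _

lemma hasDerivAt_phase (x t : ℝ) :
    HasDerivAt (phase x) (phase x t * (Complex.I * (x * Real.cos t : ℝ))) t := by
  have h : HasDerivAt (fun s : ℝ => ((x * Real.sin s : ℝ) : ℂ)) ((x * Real.cos t : ℝ) : ℂ) t :=
    ((Real.hasDerivAt_sin t).const_mul x).ofReal_comp
  exact (h.const_mul Complex.I).cexp

/-- `J_n(x)` is the `n`-th Fourier coefficient of `t ↦ e^{i x sin t}`. -/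
lemma besselJ_eq_integral (n : ℤ) (x : ℝ) :
    (besselJ n x : ℂ) =
      (1 / (2 * π) : ℂ) * ∫ t in (-π)..π, Complex.exp (-(Complex.I * (n * t))) * phase x t := by
  have key : ∀ t : ℝ, Complex.exp (-(Complex.I * (n * t))) * phase x t
      = ((Real.cos (n * t - x * Real.sin t) : ℝ) : ℂ)
        - Complex.I * ((Real.sin (n * t - x * Real.sin t) : ℝ) : ℂ) := by
    intro t
    rw [phase, ← Complex.exp_add]
    have : -(Complex.I * (n * t)) + Complex.I * ((x * Real.sin t : ℝ) : ℂ)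
        = ((-(n * t - x * Real.sin t) : ℝ) : ℂ) * Complex.I := by push_cast; ring
    rw [this, Complex.exp_mul_I, ← Complex.ofReal_cos, ← Complex.ofReal_sin, Real.cos_neg,
      Real.sin_neg]
    push_cast; ring
  have hodd : ∫ t in (-π)..π, Real.sin (n * t - x * Real.sin t) = 0 := by
    have h := intervalIntegral.integral_comp_neg (a := -π) (b := π)
      (fun t : ℝ => Real.sin (n * t - x * Real.sin t))
    have h2 : ∀ t : ℝ, Real.sin (n * (-t) - x * Real.sin (-t))
        = -Real.sin (n * t - x * Real.sin t) := by
      intro t; rw [← Real.sin_neg (n * t - x * Real.sin t), Real.sin_neg t]; congr 1; ring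
    simp only [h2, intervalIntegral.integral_neg, neg_neg] at h
    linarith
  simp_rw [key]
  rw [intervalIntegral.integral_sub, intervalIntegral.integral_const_mul,
    intervalIntegral.integral_ofReal, intervalIntegral.integral_ofReal, hodd, besselJ]
  · push_cast; ring
  · apply Continuous.intervalIntegrable; fun_prop
  · apply Continuous.intervalIntegrable; fun_prop

/-- Integration by parts against `e^{-int}` for functions with equal end-point values. -/
lemma norm_integral_le {f f' : ℝ → ℂ} (hf : ∀ t, HasDerivAt f (f' t) t) (hc : Continuous f')
    (hp : f π = f (-π)) {n : ℤ} (hn : n ≠ 0) :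
    ‖∫ t in (-π)..π, Complex.exp (-(Complex.I * (n * t))) * f t‖ =
      1 / |(n : ℝ)| * ‖∫ t in (-π)..π, Complex.exp (-(Complex.I * (n * t))) * f' t‖ := by
  have hn' : (n : ℂ) ≠ 0 := by exact_mod_cast hn
  have hE : ∀ t : ℝ, HasDerivAt
      (fun s : ℝ => (-(Complex.I * n))⁻¹ * Complex.exp (-(Complex.I * (n * s))))
      (Complex.exp (-(Complex.I * (n * t)))) t := by
    intro t
    have h1 : HasDerivAt (fun s : ℝ => -(Complex.I * (n * (s : ℂ)))) (-(Complex.I * (n * 1))) t :=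
      (((hasDerivAt_id t).ofReal_comp.const_mul (n : ℂ)).const_mul Complex.I).neg
    have h2 := (h1.cexp).const_mul ((-(Complex.I * n))⁻¹)
    convert! h2 using 1
    field_simp
  have hper : Complex.exp (-(Complex.I * (n * (π : ℝ)))) =
      Complex.exp (-(Complex.I * (n * ((-π : ℝ) : ℂ)))) := by
    rw [Complex.exp_eq_exp_iff_exists_int]
    exact ⟨-n, by push_cast; ring⟩
  have hparts := intervalIntegral.integral_mul_deriv_eq_deriv_mul (a := -π) (b := π)
    (u := f) (u' := f')
    (v := fun s : ℝ => (-(Complex.I * n))⁻¹ * Complex.exp (-(Complex.I * (n * s))))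
    (v' := fun t : ℝ => Complex.exp (-(Complex.I * (n * t))))
    (fun t _ => hf t) (fun t _ => hE t) (hc.intervalIntegrable _ _)
    (Continuous.intervalIntegrable (by fun_prop) _ _)
  rw [hper, hp, sub_self, zero_sub] at hparts
  have e1 : (fun t : ℝ => Complex.exp (-(Complex.I * (n * t))) * f t)
      = fun t : ℝ => f t * Complex.exp (-(Complex.I * (n * t))) := by
    funext t; ring
  have e2 : (fun t : ℝ => f' t * ((-(Complex.I * n))⁻¹ * Complex.exp (-(Complex.I * (n * t)))))
      = fun t : ℝ => (-(Complex.I * n))⁻¹ * (Complex.exp (-(Complex.I * (n * t))) * f' t) := by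
    funext t; ring
  rw [e1, hparts, e2, intervalIntegral.integral_const_mul, norm_neg, norm_mul]
  simp

lemma summable_besselJ (x : ℝ) : Summable (fun n : ℤ => ‖(besselJ n x : ℂ)‖) := by
  have hc1 : Continuous (fun t : ℝ => phase x t * (Complex.I * (x * Real.cos t : ℝ))) :=
    (continuous_phase x).mul (by fun_prop)
  have hd2 : ∀ t : ℝ, HasDerivAt (fun t : ℝ => phase x t * (Complex.I * (x * Real.cos t : ℝ)))
      (phase x t * (Complex.I * (x * Real.cos t : ℝ)) * (Complex.I * (x * Real.cos t : ℝ))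
        + phase x t * (Complex.I * (x * -Real.sin t : ℝ))) t := by
    intro t
    have h : HasDerivAt (fun s : ℝ => ((x * Real.cos s : ℝ) : ℂ)) ((x * -Real.sin t : ℝ) : ℂ) t :=
      ((Real.hasDerivAt_cos t).const_mul x).ofReal_comp
    exact (hasDerivAt_phase x t).mul (h.const_mul Complex.I)
  set F : ℝ → ℂ := fun t => phase x t * (Complex.I * (x * Real.cos t : ℝ))
    * (Complex.I * (x * Real.cos t : ℝ)) + phase x t * (Complex.I * (x * -Real.sin t : ℝ)) with hF
  have hcp := continuous_phase x
  have hc2 : Continuous F :=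
    (hc1.mul (by fun_prop)).add (hcp.mul (by fun_prop))
  set M : ℝ := ∫ t in (-π)..π, ‖F t‖ with hM
  have hpi : -π ≤ π := by linarith [Real.pi_pos]
  have hbound : ∀ n : ℤ, n ≠ 0 → ‖(besselJ n x : ℂ)‖ ≤ (1 / (2 * π) * M) * (1 / (n : ℝ) ^ 2) := by
    intro n hn
    have h3 : ‖∫ t in (-π)..π, Complex.exp (-(Complex.I * (n * t))) * F t‖ ≤ M := by
      refine (intervalIntegral.norm_integral_le_integral_norm hpi).trans (le_of_eq ?_)
      refine intervalIntegral.integral_congr fun t _ => ?_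
      have : ‖Complex.exp (-(Complex.I * (n * t)))‖ = 1 := by
        rw [Complex.norm_exp]; simp
      simp only [norm_mul, this, one_mul]
    rw [besselJ_eq_integral, norm_mul, norm_integral_le (hasDerivAt_phase x) hc1 (by simp [phase]) hn,
      norm_integral_le hd2 hc2 (by simp [phase]) hn]
    have h4 : ‖(1 / (2 * π) : ℂ)‖ = 1 / (2 * π) := by
      rw [show (1 / (2 * π) : ℂ) = ((1 / (2 * π) : ℝ) : ℂ) by push_cast; ring,
        Complex.norm_real, Real.norm_of_nonneg (by positivity)]
    rw [h4, ← sq_abs (n : ℝ)]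
    have : 1 / (2 * π) * (1 / |(n : ℝ)| * (1 / |(n : ℝ)| *
        ‖∫ t in (-π)..π, Complex.exp (-(Complex.I * (n * t))) * F t‖)) =
        (1 / (2 * π) * ‖∫ t in (-π)..π, Complex.exp (-(Complex.I * (n * t))) * F t‖)
          * (1 / |(n : ℝ)| ^ 2) := by
      ring
    rw [this]
    gcongr
  have hs : Summable (fun n : ℤ => (1 / (2 * π) * M) * (1 / (n : ℝ) ^ 2)) :=
    (Real.summable_one_div_int_pow.2 (by norm_num)).mul_left _
  refine Summable.of_norm_bounded_eventually hs ?_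
  have : ({0} : Set ℤ).Finite := Set.finite_singleton 0
  filter_upwards [this.compl_mem_cofinite] with n hn
  rw [norm_norm]
  exact hbound n hn

lemma norm_shift_le (j : ℤ) : ‖shift j‖ ≤ 1 := (shiftIsometry j).norm_toContinuousLinearMap_le

/-- The series defining `U_θ` converges absolutely in operator norm. -/
lemma summable_U (g : ℂ) (θ : ℝ) : Summable (fun j : ℤ =>
    (Complex.exp (Complex.I * (j * θ)) * (besselJ j (2 * ‖g‖) : ℂ)) • shift j) := by
  refine Summable.of_norm_bounded (summable_besselJ (2 * ‖g‖)) fun j => ?_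
  have h : ‖Complex.exp (Complex.I * (j * θ))‖ = 1 := by
    rw [Complex.norm_exp]; simp
  rw [norm_smul, norm_mul, h, one_mul]
  exact mul_le_of_le_one_right (norm_nonneg _) (norm_shift_le j)

/-- The defining formula `U_θ e_l = ∑_k e^{i(k-l)θ} J_{k-l}(2|g|) e_k`. -/
theorem hasSum_U_e (g : ℂ) (θ : ℝ) (l : ℤ) : HasSum (fun k : ℤ =>
    (Complex.exp (Complex.I * (((k - l : ℤ) : ℂ) * θ)) * (besselJ (k - l) (2 * ‖g‖) : ℂ)) • e k)
    (U g θ (e l)) := by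
  have h := (summable_U g θ).hasSum.mapL (ContinuousLinearMap.apply ℂ L2Z (e l))
  rw [← (Equiv.subRight l).hasSum_iff] at h
  convert! h using 1
  funext k
  simp [shift_e]

/-- The forward operator `(Tρ)(θ, l) = ⟨e_l, U_θ ρ U_θ^* e_l⟩`. -/
def T (g : ℂ) (ρ : L2Z →L[ℂ] L2Z) : ℝ × ℤ → ℂ := fun p =>
  entry (U g p.1 ∘L ρ ∘L ContinuousLinearMap.adjoint (U g p.1)) p.2 p.2

/-- The norm of `L²([-π, π] × ℤ)` (Lebesgue measure times counting measure). -/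
def dataNorm (f : ℝ × ℤ → ℂ) : ℝ :=
  (eLpNorm f 2 ((volume.restrict (Set.Icc (-π) π)).prod Measure.count)).toReal

/-- `Φ(t) = exp(√((-ln t)(-ln b)))`; used for `0 < t < 1` and `0 < b < 1`. -/
def Φ (b t : ℝ) : ℝ := Real.exp (√((-Real.log t) * (-Real.log b)))

end Pinem

end

noncomputable section

namespace Pinem

open MeasureTheory Real

/-! The two states differ only on the off-diagonals `±k`, by `b ^ k` times a wide and very smooth
nonnegative weight `w`. With `x = 2|g|`, the data of this perturbation are `cos (k θ)` times a
constant multiple of the convolution of `w` with `P_k(n) = J_n(x) J_{n-k}(x)` (`T_offDiag`).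

The key is that `P_k` behaves like a `k`-th finite difference. Since `2k = 2l - 2(l-k)`, the Bessel
recurrence writes `2k P_k` as `x` times first differences of `P_{k-1}` and `P_{k+1}`
(`boxSum_iterate_besselProd`). Summing over a box of width `M` telescopes such a difference, so `k`
successive box sums leave an `ℓ¹` norm at most `K (2x)^k`, independent of `M`, where `K = (∑
|J_n(x)|)^2` (`boxSum_iterate_besselProd_le`). Taking `w` to be the `k`-fold box convolution divided
by `2 M^k` therefore makes the data of size at most `3K (2xb/M)^k`. The weight occupies about `kM`
sites, so by Cauchy–Schwarz the Hilbert–Schmidt distance is still at least of order `b^k / √(kM)`.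

For `M ≈ b^(-ak)` the data are about `b^(a k²)`, so `Φ^(-α)` is about `b^(α √a k)`, while the
distance is about `b^((1 + a/2) k)`. The distance wins once `α > (1 + a/2)/√a`; the minimum `√2` is
attained at `a = 2`, which is the choice made here.

The data are nonzero because Bessel functions of large order at a fixed point share one sign, so box
sums of `P_k` are positive far to the right. -/

/-! ### Bessel functions: recurrence, nonvanishing and signs at large order. -/

/-- The three-term recurrence of the Bessel functions. -/
lemma besselJ_recurrence (n : ℤ) (x : ℝ) :
    2 * n * besselJ n x = x * (besselJ (n - 1) x + besselJ (n + 1) x) := by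
  have hd : ∀ t : ℝ, HasDerivAt (fun s : ℝ => Real.sin (n * s - x * Real.sin s))
      (Real.cos (n * t - x * Real.sin t) * (n * 1 - x * Real.cos t)) t := fun t =>
    (((hasDerivAt_id t).const_mul (n : ℝ)).sub ((Real.hasDerivAt_sin t).const_mul x)).sin
  -- The integrand is the derivative of `sin (n t - x sin t)`, which vanishes at `±π`.
  have h0 : ∫ t in (-π)..π, Real.cos (n * t - x * Real.sin t) * (n * 1 - x * Real.cos t) = 0 := by
    rw [intervalIntegral.integral_eq_sub_of_hasDerivAt (fun t _ => hd t)
      (Continuous.intervalIntegrable (by fun_prop) _ _)]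
    simp [Real.sin_int_mul_pi]
  have h1 : ∀ m : ℤ, IntervalIntegrable (fun t : ℝ => Real.cos (m * t - x * Real.sin t))
      volume (-π) π := fun m => Continuous.intervalIntegrable (by fun_prop) _ _
  have h2 : ∫ t in (-π)..π, Real.cos (n * t - x * Real.sin t) * (n * 1 - x * Real.cos t)
      = n * (∫ t in (-π)..π, Real.cos (n * t - x * Real.sin t))
        - x / 2 * ((∫ t in (-π)..π, Real.cos ((n - 1 : ℤ) * t - x * Real.sin t))
          + ∫ t in (-π)..π, Real.cos ((n + 1 : ℤ) * t - x * Real.sin t)) := by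
    rw [← intervalIntegral.integral_add (h1 _) (h1 _), ← intervalIntegral.integral_const_mul,
      ← intervalIntegral.integral_const_mul, ← intervalIntegral.integral_sub
        ((h1 n).const_mul _) (((h1 _).add (h1 _)).const_mul _)]
    refine intervalIntegral.integral_congr fun t _ => ?_
    have e1 : ((n - 1 : ℤ) : ℝ) * t - x * Real.sin t = (n * t - x * Real.sin t) - t := by
      push_cast; ring
    have e2 : ((n + 1 : ℤ) : ℝ) * t - x * Real.sin t = (n * t - x * Real.sin t) + t := by
      push_cast; ring
    simp only [e1, e2, Real.cos_sub _ t, Real.cos_add _ t]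
    ring
  rw [h2] at h0
  unfold besselJ
  linear_combination (1 / π) * h0

/-- For fixed `x`, not all Bessel functions vanish at `x`. -/
lemma exists_besselJ_ne_zero (x : ℝ) : ∃ n : ℤ, besselJ n x ≠ 0 := by
  by_contra! h
  have hab : -π < π := by linarith [Real.pi_pos]
  have hL2 : MemLp (phase x) 2 (volume.restrict (Set.Ioc (-π) π)) :=
    MemLp.of_bound (continuous_phase x).aestronglyMeasurable 1
      (Filter.Eventually.of_forall fun t => (norm_phase x t).le)
  -- Parseval: if all Fourier coefficients vanished, the mean square of the unimodular `phase x`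
  -- would be `0` instead of `1`.
  have hs := hasSum_sq_fourierCoeffOn hab hL2
  have hz : ∀ i : ℤ, fourierCoeffOn hab (phase x) i = 0 := by
    intro i
    have h1 := besselJ_eq_integral i x
    rw [h i] at h1
    have h2 : ∫ t in (-π)..π, Complex.exp (-(Complex.I * (i * t))) * phase x t = 0 := by
      have h3 : (1 / (2 * π) : ℂ) ≠ 0 := 
        one_div_ne_zero (mul_ne_zero two_ne_zero (by exact_mod_cast Real.pi_ne_zero))
      simpa [h3] using h1.symm
    rw [fourierCoeffOn_eq_integral, ← h2]
    have : ∀ t : ℝ, fourier (-i) (t : AddCircle (π - -π)) • phase x t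
        = Complex.exp (-(Complex.I * (i * t))) * phase x t := by
      intro t
      rw [fourier_coe_apply, smul_eq_mul]
      congr 2
      have : (π : ℂ) ≠ 0 := by exact_mod_cast Real.pi_ne_zero
      push_cast
      field_simp
      ring
    simp_rw [this, h2, smul_zero]
  simp only [hz, norm_phase, norm_zero, ne_eq, OfNat.ofNat_ne_zero, not_false_eq_true,
    zero_pow] at hs
  have := hs.unique hasSum_zero
  simp at this

lemma summable_abs_besselJ (x : ℝ) : Summable (fun n : ℤ => |besselJ n x|) := by
  simpa [Complex.norm_real] using summable_besselJ x

/-- At a fixed point `x > 0`, the Bessel functions of large order are nonzero and have the same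
sign. -/
lemma eventually_besselJ_mul_succ_pos {x : ℝ} (hx : 0 < x) :
    ∃ N : ℤ, ∀ n : ℤ, N ≤ n → 0 < besselJ n x * besselJ (n + 1) x := by
  set J : ℤ → ℝ := fun n => besselJ n x with hJ
  have hrec : ∀ n : ℤ, 2 * n * J n = x * (J (n - 1) + J (n + 1)) :=
    fun n => besselJ_recurrence n x
  -- two consecutive zeros propagate
  have hzero : ∀ n : ℤ, ¬ (J n = 0 ∧ J (n + 1) = 0) := by
    rintro n ⟨h0, h1⟩
    obtain ⟨m, hm⟩ := exists_besselJ_ne_zero x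
    have hall : ∀ i : ℕ, (J (n + i) = 0 ∧ J (n + i + 1) = 0) ∧ (J (n - i) = 0 ∧ J (n - i + 1) = 0) := by
      intro i
      induction i with
      | zero => simp [h0, h1]
      | succ i ih =>
        obtain ⟨⟨a1, a2⟩, a3, a4⟩ := ih
        push_cast
        refine ⟨⟨by rw [← add_assoc]; exact a2, ?_⟩, ?_, ?_⟩
        · have := hrec (n + i + 1)
          rw [add_sub_cancel_right, a1, a2] at this
          rw [← add_assoc]
          simpa [hx.ne'] using this.symm
        · have := hrec (n - i)
          rw [a3, a4] at this
          rw [← sub_sub]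
          simpa [hx.ne'] using this.symm
        · rw [← sub_sub, sub_add_cancel]; exact a3
    rcases le_total n m with h | h
    · have := (hall (m - n).toNat).1.1
      rw [Int.toNat_of_nonneg (by omega), add_sub_cancel] at this
      exact hm this
    · have := (hall (n - m).toNat).2.1
      rw [Int.toNat_of_nonneg (by omega), sub_sub_cancel] at this
      exact hm this
  obtain ⟨N, hN⟩ := exists_int_gt x
  have hN0 : (0 : ℝ) < N := hx.trans hN
  -- the absolute values are strictly decreasing
  have hdec : ∀ n : ℤ, N ≤ n → |J (n + 1)| < |J n| := by
    intro n hn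
    by_contra! hle
    -- For orders at least `x`, the recurrence gives `2|J_m| ≤ |J_(m-1)| + |J_(m+1)|`, so one
    -- non-decreasing step forces all later ones. This contradicts summability unless `J_n` and
    -- `J_(n+1)` both vanish.
    have hgrow : ∀ i : ℕ, |J (n + i)| ≤ |J (n + i + 1)| := by
      intro i
      induction i with
      | zero => simpa using hle
      | succ i ih =>
        have h := hrec (n + i + 1)
        rw [add_sub_cancel_right] at h
        have hc : x ≤ ((n + i + 1 : ℤ) : ℝ) := by
          have : (N : ℝ) ≤ ((n + i + 1 : ℤ) : ℝ) := by exact_mod_cast (by omega)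
          linarith
        have h2 : 2 * ((n + i + 1 : ℤ) : ℝ) * |J (n + i + 1)|
            ≤ x * (|J (n + i)| + |J (n + i + 1 + 1)|) := by
          have := congrArg abs h
          rw [abs_mul, abs_mul, abs_mul, abs_of_pos hx, abs_of_pos (a := ((n + i + 1 : ℤ) : ℝ))
            (hx.trans_le hc), abs_two] at this
          rw [this]
          gcongr
          exact abs_add_le _ _
        have h3 := mul_le_mul_of_nonneg_right hc (abs_nonneg (J (n + i + 1)))
        push_cast
        rw [← add_assoc]
        have h4 : x * |J (n + i + 1)| ≤ x * |J (n + i + 1 + 1)| := by nlinarith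
        exact le_of_mul_le_mul_left h4 hx
    have hlow : ∀ i : ℕ, |J (n + 1)| ≤ |J (n + 1 + i)| := by
      intro i
      induction i with
      | zero => simp
      | succ i ih =>
        refine ih.trans ?_
        have := hgrow (i + 1)
        push_cast at this ⊢
        convert! this using 3 <;> ring
    have hinj : Function.Injective (fun i : ℕ => n + 1 + (i : ℤ)) := fun a b hab => by
      simpa using hab
    have ht := ((summable_abs_besselJ x).comp_injective hinj).tendsto_atTop_zero
    have h0 : |J (n + 1)| ≤ 0 := ge_of_tendsto' ht hlow
    have h1 : J (n + 1) = 0 := abs_nonpos_iff.1 h0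
    refine hzero n ⟨?_, h1⟩
    rw [h1, abs_zero] at hle
    exact abs_nonpos_iff.1 hle
  refine ⟨N, fun n hn => ?_⟩
  have h := hrec (n + 1)
  rw [add_sub_cancel_right] at h
  have hlt : |J (n + 1 + 1)| < |J n| := (hdec (n + 1) (by omega)).trans (hdec n hn)
  -- `J_n` strictly dominates `J_(n+2)`, so the right side of the recurrence at `n + 1`, and hence
  -- `J_(n+1)`, has the sign of `J_n`.
  have hpos : 0 < J n * (J n + J (n + 1 + 1)) := by
    have h1 : -(|J n| * |J (n + 1 + 1)|) ≤ J n * J (n + 1 + 1) := by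
      rw [← abs_mul]; exact neg_abs_le _
    have h2 : |J n| * |J (n + 1 + 1)| < |J n| * |J n| :=
      mul_lt_mul_of_pos_left hlt ((abs_nonneg _).trans_lt hlt)
    have h3 := abs_mul_abs_self (J n)
    nlinarith
  have hn1 : (0 : ℝ) < 2 * ((n + 1 : ℤ) : ℝ) := by
    have : (N : ℝ) ≤ ((n + 1 : ℤ) : ℝ) := by exact_mod_cast (by omega)
    linarith
  have h5 : 0 < 2 * ((n + 1 : ℤ) : ℝ) * (J n * J (n + 1)) := by
    have : 2 * ((n + 1 : ℤ) : ℝ) * (J n * J (n + 1)) = x * (J n * (J n + J (n + 1 + 1))) := by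
      linear_combination J n * h
    rw [this]; positivity
  exact (mul_pos_iff_of_pos_left hn1).1 h5

/-! ### Iterated box sums of Bessel products. -/

/-- The convolution of a sequence with the indicator function of `{0, …, M - 1}`. -/
def boxSum (M : ℕ) (f : ℤ → ℝ) (l : ℤ) : ℝ := ∑ i ∈ Finset.range M, f (l - i)

/-- The `m`-fold convolution power of the indicator function of `{0, …, M - 1}`. -/
def boxPow (M m : ℕ) : ℤ → ℝ := (boxSum M)^[m] (Pi.single 0 1)

/-- The products `J_n(x) J_{n-k}(x)`. -/
def besselProd (x : ℝ) (k n : ℤ) : ℝ := besselJ n x * besselJ (n - k) x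

lemma boxPow_succ (M m : ℕ) (j : ℤ) :
    boxPow M (m + 1) j = ∑ i ∈ Finset.range M, boxPow M m (j - i) := by
  simp only [boxPow, Function.iterate_succ_apply', boxSum]

lemma boxPow_nonneg (M m : ℕ) (j : ℤ) : 0 ≤ boxPow M m j := by
  induction m generalizing j with
  | zero =>
    simp only [boxPow, Function.iterate_zero, id, Pi.single_apply]
    split_ifs <;> norm_num
  | succ m ih => rw [boxPow_succ]; exact Finset.sum_nonneg fun i _ => ih _

lemma boxPow_eq_zero (M m : ℕ) (j : ℤ) (hj : j ∉ Finset.Icc (0 : ℤ) (m * M)) :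
    boxPow M m j = 0 := by
  induction m generalizing j with
  | zero =>
    simp only [boxPow, Function.iterate_zero, id, Pi.single_apply]
    rw [if_neg]
    rintro rfl
    simp at hj
  | succ m ih =>
    rw [boxPow_succ]
    refine Finset.sum_eq_zero fun i hi => ih _ ?_
    rw [Finset.mem_range] at hi
    rw [Finset.mem_Icc] at hj ⊢
    push_cast at hj
    rintro ⟨h1, h2⟩
    exact hj ⟨by omega, by rw [add_mul, one_mul]; omega⟩

/-- Iterated box sums are convolutions with `boxPow`. -/
lemma hasSum_boxPow_mul (M m : ℕ) (f : ℤ → ℝ) (l : ℤ) :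
    HasSum (fun j : ℤ => boxPow M m j * f (l - j)) ((boxSum M)^[m] f l) := by
  induction m generalizing l with
  | zero =>
    convert! hasSum_ite_eq (0 : ℤ) (f l) using 1
    funext j
    simp only [boxPow, Function.iterate_zero, id, Pi.single_apply]
    split_ifs with h <;> simp [h]
  | succ m ih =>
    rw [Function.iterate_succ_apply', boxSum]
    simp only [boxPow_succ, Finset.sum_mul]
    refine hasSum_sum fun i _ => ?_
    have h := ih (l - i)
    rw [← (Equiv.subRight (i : ℤ)).hasSum_iff] at h
    convert! h using 1
    funext j
    simp

/-- Convolve with the constant sequence `1`: each box sum multiplies it by `M`. -/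
lemma hasSum_boxPow (M m : ℕ) : HasSum (boxPow M m) ((M : ℝ) ^ m) := by
  have h := hasSum_boxPow_mul M m (fun _ => 1) 0
  have h1 : ∀ l, (boxSum M)^[m] (fun _ => 1) l = (M : ℝ) ^ m := by
    induction m with
    | zero => simp
    | succ m ih =>
      intro l
      have := ih (hasSum_boxPow_mul M m (fun _ => 1) 0)
      rw [Function.iterate_succ_apply', boxSum]
      simp only [this]
      simp [pow_succ, mul_comm]
  simpa [h1] using h

/-- The recurrence for iterated box sums of Bessel products. -/
lemma boxSum_iterate_besselProd (x : ℝ) (M m : ℕ) (k l : ℤ) :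
    2 * k * (boxSum M)^[m] (besselProd x k) l =
      x * ((boxSum M)^[m] (besselProd x (k - 1)) (l - 1)
          - (boxSum M)^[m] (besselProd x (k - 1)) l
        + ((boxSum M)^[m] (besselProd x (k + 1)) (l + 1)
          - (boxSum M)^[m] (besselProd x (k + 1)) l)) := by
  induction m generalizing l with
  | zero =>
    -- Subtracting the recurrences at orders `l` and `l - k`, each multiplied by the other Bessel
    -- factor, leaves `2l - 2(l-k) = 2k` on the left.
    have h1 := besselJ_recurrence l x
    have h2 := besselJ_recurrence (l - k) x
    simp only [Function.iterate_zero, id, besselProd]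
    rw [show l - 1 - (k - 1) = l - k by ring, show l - (k - 1) = l - k + 1 by ring,
      show l + 1 - (k + 1) = l - k by ring, show l - (k + 1) = l - k - 1 by ring]
    push_cast at h2
    linear_combination besselJ (l - k) x * h1 - besselJ l x * h2
  | succ m ih =>
    simp only [Function.iterate_succ_apply', boxSum]
    rw [Finset.mul_sum, ← Finset.sum_sub_distrib, ← Finset.sum_sub_distrib,
      ← Finset.sum_add_distrib, Finset.mul_sum]
    refine Finset.sum_congr rfl fun i _ => ?_
    rw [ih, show l - i - 1 = l - 1 - i by ring, show l - i + 1 = l + 1 - i by ring]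

/-- Telescoping: the width `M` survives only as a shift of the argument, not as a number of terms.
This is what keeps the later bounds uniform in `M`. -/
lemma boxSum_sub_one_sub (M : ℕ) (f : ℤ → ℝ) (l : ℤ) :
    boxSum M f (l - 1) - boxSum M f l = f (l - M) - f l := by
  have := Finset.sum_range_sub (fun i : ℕ => f (l - i)) M
  simp only [Nat.cast_zero, sub_zero] at this
  rw [← this, Finset.sum_sub_distrib, boxSum, boxSum]
  congr 1
  refine Finset.sum_congr rfl fun i _ => ?_
  congr 1
  push_cast; ring

lemma summable_comp_add {f : ℤ → ℝ} (hf : Summable f) (a : ℤ) :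
    Summable (fun l => f (l + a)) :=
  (Equiv.addRight a).summable_iff.2 hf

lemma tsum_comp_add (f : ℤ → ℝ) (a : ℤ) : ∑' l, f (l + a) = ∑' l, f l :=
  (Equiv.addRight a).tsum_eq f

/-- `ℓ¹` bound for the Bessel products. -/
lemma summable_besselProd (x : ℝ) (k : ℤ) :
    Summable (fun l => |besselProd x k l|) ∧
      ∑' l, |besselProd x k l| ≤ (∑' n, |besselJ n x|) ^ 2 := by
  have hs := summable_abs_besselJ x
  have hle : ∀ l, |besselProd x k l| ≤ |besselJ l x| * ∑' n, |besselJ n x| := by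
    intro l
    rw [besselProd, abs_mul]
    gcongr
    exact hs.le_tsum (l - k) fun j _ => abs_nonneg _
  have h1 := Summable.of_nonneg_of_le (fun l => abs_nonneg _) hle (hs.mul_right _)
  refine ⟨h1, (h1.tsum_le_tsum hle (hs.mul_right _)).trans (le_of_eq ?_)⟩
  rw [tsum_mul_right, sq]

/-- The `m`-fold box sum of `J_n J_{n-k}` is bounded in `ℓ¹`, uniformly in the width of the box,
as long as `m ≤ |k|`. -/
lemma boxSum_iterate_besselProd_le {x : ℝ} (hx : 0 < x) (M m : ℕ) (k : ℤ) (hk : (m : ℤ) ≤ |k|) :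
    Summable (fun l => |(boxSum M)^[m] (besselProd x k) l|) ∧
      ∑' l, |(boxSum M)^[m] (besselProd x k) l| ≤ (∑' n, |besselJ n x|) ^ 2 * (2 * x) ^ m := by
  induction m generalizing k with
  | zero => simpa using summable_besselProd x k
  | succ m ih =>
    push_cast at hk
    -- Each step moves `k` to a neighbour, costing at most one unit of `|k|`; this is why `m ≤ |k|`
    -- is required.
    have hk1 : (m : ℤ) ≤ |k - 1| := by
      have := abs_sub_abs_le_abs_sub k 1
      rw [abs_one] at this; omega
    have hk2 : (m : ℤ) ≤ |k + 1| := by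
      have := abs_sub_abs_le_abs_sub k (-1)
      rw [abs_neg, abs_one, sub_neg_eq_add] at this; omega
    obtain ⟨s1, t1⟩ := ih _ hk1
    obtain ⟨s2, t2⟩ := ih _ hk2
    set f := (boxSum M)^[m] (besselProd x (k - 1)) with hf
    set g := (boxSum M)^[m] (besselProd x (k + 1)) with hg
    -- The outermost of the `m + 1` box sums telescopes the differences in the recurrence, leaving
    -- four values of `m`-fold sums. Dividing by `2|k| ≥ 2` gives the factor `x / 2`, and the four
    -- terms together contribute `2x` to the `ℓ¹` bound.
    have key : ∀ l, |(boxSum M)^[m + 1] (besselProd x k) l| ≤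
        x / 2 * (|f (l + -M)| + |f l| + (|g (l + 1)| + |g (l + (1 - M))|)) := by
      intro l
      have h := boxSum_iterate_besselProd x M (m + 1) k l
      have e2 := boxSum_sub_one_sub M g (l + 1)
      rw [add_sub_cancel_right] at e2
      rw [Function.iterate_succ_apply' _ _ (besselProd x (k - 1)),
        Function.iterate_succ_apply' _ _ (besselProd x (k + 1)), ← hf, ← hg,
        boxSum_sub_one_sub, ← neg_sub (boxSum M g l), e2] at h
      have h1 := congrArg abs h
      rw [abs_mul, abs_mul, abs_mul, abs_of_pos hx, abs_two] at h1
      have hk' : (1 : ℝ) ≤ |(k : ℝ)| := by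
        have : (1 : ℤ) ≤ |k| := by omega
        exact_mod_cast this
      have h2 : |f (l - M) - f l + -(g (l + 1 - M) - g (l + 1))| ≤
          |f (l + -M)| + |f l| + (|g (l + 1)| + |g (l + (1 - M))|) := by
        rw [← sub_eq_add_neg l, ← add_sub_assoc l, neg_sub]
        exact (abs_add_le _ _).trans (add_le_add (abs_sub _ _) (abs_sub _ _))
      have h3 := mul_le_mul_of_nonneg_left h2 hx.le
      have h4 := mul_le_mul_of_nonneg_right hk' (abs_nonneg ((boxSum M)^[m + 1] (besselProd x k) l))
      nlinarith
    have hs := (((summable_comp_add s1 (-M)).add s1).add ((summable_comp_add s2 1).add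
      (summable_comp_add s2 (1 - M)))).mul_left (x / 2)
    have hs' := Summable.of_nonneg_of_le (fun l => abs_nonneg _) key hs
    refine ⟨hs', (hs'.tsum_le_tsum key hs).trans ?_⟩
    rw [tsum_mul_left, Summable.tsum_add ((summable_comp_add s1 (-M)).add s1)
      ((summable_comp_add s2 1).add (summable_comp_add s2 (1 - M))),
      Summable.tsum_add (summable_comp_add s1 (-M)) s1,
      Summable.tsum_add (summable_comp_add s2 1) (summable_comp_add s2 (1 - M)),
      tsum_comp_add (fun l => |f l|), tsum_comp_add (fun l => |g l|),
      tsum_comp_add (fun l => |g l|)]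
    set B := (∑' n, |besselJ n x|) ^ 2 * (2 * x) ^ m
    calc x / 2 * (∑' l, |f l| + ∑' l, |f l| + (∑' l, |g l| + ∑' l, |g l|))
        ≤ x / 2 * (B + B + (B + B)) := by gcongr
      _ = (∑' n, |besselJ n x|) ^ 2 * (2 * x) ^ (m + 1) := by simp only [B]; ring

/-- Iterated box sums of Bessel products do not vanish identically. -/
lemma exists_boxSum_iterate_besselProd_ne_zero {x : ℝ} (hx : 0 < x) {M : ℕ} (hM : 0 < M) (m k : ℕ) :
    ∃ l, (boxSum M)^[m] (besselProd x k) l ≠ 0 := by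
  obtain ⟨N, hN⟩ := eventually_besselJ_mul_succ_pos hx
  have hJ : ∀ k : ℕ, ∀ n, N ≤ n → 0 < besselJ n x * besselJ (n + k) x := by
    intro k
    induction k with
    | zero =>
      intro n hn
      have := hN n hn
      simpa using (left_ne_zero_of_mul this.ne').lt_or_gt
    | succ k ih =>
      intro n hn
      have h1 := ih n hn
      have h2 := hN (n + k) (by omega)
      have h3 := mul_pos h1 h2
      push_cast
      rw [← add_assoc]
      -- Signs are chained through the common neighbour `J_(n+k)`, which enters as a square.
      have h4 : besselJ n x * besselJ (n + k) x * (besselJ (n + k) x * besselJ (n + k + 1) x)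
        = besselJ (n + k) x ^ 2 * (besselJ n x * besselJ (n + k + 1) x) := by ring
      rw [h4] at h3
      exact pos_of_mul_pos_right h3 (sq_nonneg _)
  -- Each box sum looks back fewer than `M` sites, so moving the threshold by `M` per step keeps
  -- every summand in the positive range.
  have hpos : ∀ m : ℕ, ∀ l : ℤ, N + k + m * M ≤ l → 0 < (boxSum M)^[m] (besselProd x k) l := by
    intro m
    induction m with
    | zero =>
      intro l hl
      have := hJ k (l - k) (by simp at hl; omega)
      rw [sub_add_cancel, mul_comm] at this
      exact this
    | succ m ih =>
      intro l hl
      rw [Function.iterate_succ_apply', boxSum]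
      refine Finset.sum_pos (fun i hi => ih _ ?_) (Finset.nonempty_range_iff.2 hM.ne')
      rw [Finset.mem_range] at hi
      push_cast at hl
      rw [add_mul, one_mul] at hl
      omega
  exact ⟨_, (hpos m _ le_rfl).ne'⟩

/-! ### The band states: matrix entries, positivity, decay and Hilbert–Schmidt norm. -/

lemma inner_e_left (k : ℤ) (v : L2Z) : inner ℂ (e k) v = (v : ∀ _ : ℤ, ℂ) k := by
  rw [e, lp.inner_single_left]
  simp

lemma inner_e_e (k l : ℤ) : inner ℂ (e k) (e l) = if k = l then (1 : ℂ) else 0 := by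
  rw [inner_e_left, e, lp.single_apply, Pi.single_apply]

/-- The matrix of `U_θ`. -/
lemma inner_e_U_e (g : ℂ) (θ : ℝ) (l j : ℤ) : inner ℂ (e l) (U g θ (e j)) =
    Complex.exp (Complex.I * (((l - j : ℤ) : ℂ) * θ)) * (besselJ (l - j) (2 * ‖g‖) : ℂ) := by
  have h := (hasSum_U_e g θ j).mapL (innerSL ℂ (e l))
  refine h.unique ?_
  convert! hasSum_ite_eq l (Complex.exp (Complex.I * (((l - j : ℤ) : ℂ) * θ)) *
    (besselJ (l - j) (2 * ‖g‖) : ℂ)) using 1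
  funext k
  rw [innerSL_apply_apply, inner_smul_right, inner_e_e]
  split_ifs with h1 h2 h2
  · rw [h1, mul_one]
  · exact absurd h1.symm h2
  · exact absurd h2.symm h1
  · rw [mul_zero]

/-- The operator `∑_{j ∈ s} w_j |e_{j+u}⟩⟨e_{j+v}|`. -/
def band (s : Finset ℤ) (w : ℤ → ℝ) (u v : ℤ) : L2Z →L[ℂ] L2Z :=
  ∑ j ∈ s, (w j : ℂ) • InnerProductSpace.rankOne ℂ (e (j + u)) (e (j + v))

lemma entry_add (A B : L2Z →L[ℂ] L2Z) (p q : ℤ) : entry (A + B) p q = entry A p q + entry B p q := by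
  simp [entry]

lemma entry_smul (c : ℂ) (A : L2Z →L[ℂ] L2Z) (p q : ℤ) : entry (c • A) p q = c * entry A p q := by
  simp [entry]

lemma entry_band {s : Finset ℤ} {w : ℤ → ℝ} (hw : ∀ j, j ∉ s → w j = 0) (u v p q : ℤ) :
    entry (band s w u v) p q = if q = p + (v - u) then (w (p - u) : ℂ) else 0 := by
  have h : entry (band s w u v) p q =
      ∑ j ∈ s, if j = p - u then (if q = p + (v - u) then (w (p - u) : ℂ) else 0) else 0 := by
    simp only [entry, band, sum_apply, inner_sum]
    refine Finset.sum_congr rfl fun j _ => ?_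
    rw [smul_apply, InnerProductSpace.rankOne_apply, inner_smul_right,
      inner_smul_right, inner_e_e, inner_e_e]
    by_cases h1 : j = p - u
    · subst h1
      rw [if_pos rfl, if_pos (by ring : p = p - u + u)]
      by_cases h2 : q = p + (v - u)
      · rw [if_pos h2, if_pos (by omega : p - u + v = q)]; simp
      · rw [if_neg h2, if_neg (by omega : ¬ p - u + v = q)]; simp
    · rw [if_neg h1, if_neg (by omega : ¬ p = j + u)]; simp
  rw [h, Finset.sum_ite_eq' s (p - u)]
  split_ifs with h1 h2 h2
  · rfl
  · rfl
  · rw [hw _ h1, Complex.ofReal_zero]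
  · rfl

/-- The unperturbed, diagonal density operator. -/
def diagState (s : Finset ℤ) (w : ℤ → ℝ) (k : ℤ) : L2Z →L[ℂ] L2Z :=
  band s w 0 0 + band s w k k

/-- The perturbation on the off-diagonals `±k`. -/
def offDiag (s : Finset ℤ) (w : ℤ → ℝ) (k : ℤ) : L2Z →L[ℂ] L2Z :=
  band s w 0 k + band s w k 0

-- Each site `j` contributes `w j` times a combination, with coefficients `1 - β` and `β`, of
-- projections onto `e_j` and `e_(j+k)` and the rank-one operator of `e_j + e_(j+k)`. All of these
-- are positive.
open ComplexOrder in
lemma isPositive_diagState_add {s : Finset ℤ} {w : ℤ → ℝ} (hw : ∀ j, 0 ≤ w j) (k : ℤ) {β : ℝ}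
    (h0 : 0 ≤ β) (h1 : β ≤ 1) : (diagState s w k + (β : ℂ) • offDiag s w k).IsPositive := by
  have h : diagState s w k + (β : ℂ) • offDiag s w k =
      ∑ j ∈ s, ((w j : ℝ) : ℂ) • (((1 - β : ℝ) : ℂ) • (InnerProductSpace.rankOne ℂ (e j) (e j)
          + InnerProductSpace.rankOne ℂ (e (j + k)) (e (j + k)))
        + (β : ℂ) • InnerProductSpace.rankOne ℂ (e j + e (j + k)) (e j + e (j + k))) := by
    simp only [diagState, offDiag, band, smul_add, Finset.smul_sum, ← Finset.sum_add_distrib]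
    refine Finset.sum_congr rfl fun j _ => ?_
    simp only [add_zero, map_add, add_apply]
    push_cast
    module
  rw [h]
  refine ContinuousLinearMap.isPositive_sum _ fun j _ => ?_
  have hβ : (0 : ℂ) ≤ ((1 - β : ℝ) : ℂ) := by
    exact_mod_cast sub_nonneg.2 h1
  refine ContinuousLinearMap.IsPositive.smul_of_nonneg (.add (.smul_of_nonneg
    (.add ?_ ?_) hβ) (.smul_of_nonneg ?_ ?_)) ?_
  · exact InnerProductSpace.isPositive_rankOne_self _
  · exact InnerProductSpace.isPositive_rankOne_self _
  · exact InnerProductSpace.isPositive_rankOne_self _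
  · exact_mod_cast h0
  · exact_mod_cast hw j

lemma entry_diagState_add {s : Finset ℤ} {w : ℤ → ℝ} (hs : ∀ j, j ∉ s → w j = 0) {k : ℤ}
    (hk : k ≠ 0) (β : ℝ) (l i : ℤ) :
    entry (diagState s w k + (β : ℂ) • offDiag s w k) l (l + i) =
      if i = 0 then ((w l + w (l - k) : ℝ) : ℂ) else if i = k then ((β * w l : ℝ) : ℂ)
        else if i = -k then ((β * w (l - k) : ℝ) : ℂ) else 0 := by
  simp only [entry_add, entry_smul, diagState, offDiag, entry_band hs]
  simp only [add_right_inj, sub_zero, zero_sub, sub_self]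
  by_cases h1 : i = 0
  · subst h1
    simp [hk.symm, hk]
  · by_cases h2 : i = k
    · subst h2
      have : ¬ i = -i := by omega
      simp [h1, this]
    · by_cases h3 : i = -k
      · subst h3; simp [h1, h2]
      · simp [h1, h2, h3]

lemma hasSum_comp_sub {w : ℤ → ℝ} {a : ℝ} (h : HasSum w a) (k : ℤ) :
    HasSum (fun l => w (l - k)) a :=
  (Equiv.subRight k).hasSum_iff.2 h

lemma isDensity_diagState_add {s : Finset ℤ} {w : ℤ → ℝ} (hs : ∀ j, j ∉ s → w j = 0)
    (hw : ∀ j, 0 ≤ w j) (hsum : HasSum w (1 / 2)) {k : ℤ} (hk : k ≠ 0) {β : ℝ}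
    (h0 : 0 ≤ β) (h1 : β ≤ 1) : IsDensity (diagState s w k + (β : ℂ) • offDiag s w k) := by
  refine ⟨isPositive_diagState_add hw k h0 h1, ?_⟩
  have h : ∀ l, entry (diagState s w k + (β : ℂ) • offDiag s w k) l l
      = ((w l + w (l - k) : ℝ) : ℂ) := by
    intro l
    have := entry_diagState_add hs hk β l 0
    rwa [add_zero, if_pos rfl] at this
  simp only [h]
  have := hsum.add (hasSum_comp_sub hsum k)
  rw [add_halves] at this
  simpa using Complex.hasSum_ofReal.2 this

/-- The diagonal sums to exactly `1` and the off-diagonals `±k` to `β / 2` each, so the decay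
constant `1` suffices for all parameters, including `g`. -/
lemma hasExpDecay_diagState_add {s : Finset ℤ} {w : ℤ → ℝ} (hs : ∀ j, j ∉ s → w j = 0)
    (hw : ∀ j, 0 ≤ w j) (hsum : HasSum w (1 / 2)) {k : ℤ} (hk : k ≠ 0) {b β : ℝ} (hb : 0 ≤ b)
    (h0 : 0 ≤ β) (h1 : β ≤ b ^ k.natAbs) :
    HasExpDecay b 1 (diagState s w k + (β : ℂ) • offDiag s w k) := by
  intro i
  suffices h : ∃ a ≤ b ^ i.natAbs, HasSum (fun l : ℤ =>
      ‖entry (diagState s w k + (β : ℂ) • offDiag s w k) l (l + i)‖) a by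
    obtain ⟨a, ha, h⟩ := h
    exact ⟨h.summable, by rw [h.tsum_eq, one_mul]; exact ha⟩
  simp only [entry_diagState_add hs hk]
  have hsum' := hasSum_comp_sub hsum k
  split_ifs with h2 h3 h4
  · subst h2
    refine ⟨1, by simp, ?_⟩
    have := hsum.add hsum'
    rw [add_halves] at this
    convert! this using 2 with l
    rw [Complex.norm_real, Real.norm_of_nonneg (add_nonneg (hw _) (hw _))]
  · subst h3
    refine ⟨β * (1 / 2), by linarith, ?_⟩
    convert! hsum.mul_left β using 2 with l
    rw [Complex.norm_real, Real.norm_of_nonneg (mul_nonneg h0 (hw _))]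
  · subst h4
    refine ⟨β * (1 / 2), by rw [Int.natAbs_neg]; linarith, ?_⟩
    convert! hsum'.mul_left β using 2 with l
    rw [Complex.norm_real, Real.norm_of_nonneg (mul_nonneg h0 (hw _))]
  · exact ⟨0, by positivity, by simp⟩

/-- Lower bound for the Hilbert-Schmidt norm of the perturbation. -/
lemma le_hsNorm_smul_offDiag {s : Finset ℤ} {w : ℤ → ℝ} (hs : ∀ j, j ∉ s → w j = 0)
    (hsum : HasSum w (1 / 2)) {k : ℤ} (hk : k ≠ 0) (β : ℝ) :
    β / (2 * √s.card) ≤ hsNorm ((β : ℂ) • offDiag s w k) := by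
  have hent : ∀ p q, entry ((β : ℂ) • offDiag s w k) p q =
      β * ((if q = p + k then (w p : ℂ) else 0) + if q = p - k then (w (p - k) : ℂ) else 0) := by
    intro p q
    simp only [entry_add, entry_smul, offDiag, entry_band hs, sub_eq_add_neg]
    simp
  have hsumm : Summable (fun p : ℤ × ℤ => ‖entry ((β : ℂ) • offDiag s w k) p.1 p.2‖ ^ 2) := by
    refine summable_of_hasFiniteSupport (Set.Finite.subset
      (((s ∪ s.image (· + k)).product (s.image (· + k) ∪ s)).finite_toSet) ?_)
    rintro ⟨p, q⟩ hpq
    rw [Function.mem_support] at hpq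
    by_contra hmem
    refine hpq ?_
    have : entry ((β : ℂ) • offDiag s w k) p q = 0 := by
      rw [hent]
      have h1 : (if q = p + k then (w p : ℂ) else 0) = 0 := by
        split_ifs with h
        · subst h
          by_contra h2
          have h3 : p ∈ s := by
            by_contra h3
            exact h2 (by simp [hs p h3])
          exact hmem (by simp [h3])
        · rfl
      have h2 : (if q = p - k then (w (p - k) : ℂ) else 0) = 0 := by
        split_ifs with h
        · subst h
          by_contra h2
          have h3 : p - k ∈ s := by
            by_contra h3
            exact h2 (by simp [hs _ h3])
          refine hmem ?_
          rw [Finset.mem_coe, Finset.product_eq_sprod, Finset.mem_product]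
          simp only [Finset.mem_union, Finset.mem_image]
          exact ⟨.inr ⟨_, h3, by ring⟩, .inr h3⟩
        · rfl
      rw [h1, h2]; simp
    simp only [this, norm_zero, ne_eq, OfNat.ofNat_ne_zero, not_false_eq_true, zero_pow]
  have hle : β ^ 2 * ∑ j ∈ s, w j ^ 2 ≤
      ∑' p : ℤ × ℤ, ‖entry ((β : ℂ) • offDiag s w k) p.1 p.2‖ ^ 2 := by
    have h := hsumm.sum_le_tsum (s.map ⟨fun j : ℤ => (j, j + k), fun a b h => (Prod.ext_iff.1 h).1⟩)
      fun _ _ => sq_nonneg _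
    refine le_trans (le_of_eq ?_) h
    rw [Finset.sum_map, Finset.mul_sum]
    refine Finset.sum_congr rfl fun j _ => ?_
    have : ¬ j + k = j - k := by omega
    change _ = ‖entry ((β : ℂ) • offDiag s w k) j (j + k)‖ ^ 2
    rw [hent, if_pos rfl, if_neg this]
    simp [mul_pow]
  have hs1 : ∑ j ∈ s, w j = 1 / 2 := by
    rw [← hsum.tsum_eq, tsum_eq_sum fun j hj => hs j hj]
  -- Only the `+k` off-diagonal is kept. By Cauchy–Schwarz, total mass `1/2` on `s` forces `∑ w² ≥ 1
  -- / (4 |s|)`.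
  have hcs := sq_sum_le_card_mul_sum_sq (s := s) (f := w)
  rw [hs1] at hcs
  have hc : (0 : ℝ) < s.card := by
    rcases s.card.eq_zero_or_pos with h | h
    · rw [h] at hcs; norm_num at hcs
    · exact_mod_cast h
  rw [hsNorm]
  refine Real.le_sqrt_of_sq_le (le_trans ?_ hle)
  rw [div_pow, mul_pow, Real.sq_sqrt hc.le, div_le_iff₀ (by positivity)]
  have := mul_le_mul_of_nonneg_left hcs (sq_nonneg β)
  linarith

/-! ### The data norm and the forward operator on bands. -/

/-- The data norm of a product function. -/
lemma dataNorm_mul {u : ℝ → ℝ} (hu : Continuous u) {G : ℤ → ℝ} (hG : Summable fun l => G l ^ 2) :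
    dataNorm (fun p => ((u p.1 * G p.2 : ℝ) : ℂ)) =
      √((∫ θ in (-π)..π, u θ ^ 2) * ∑' l, G l ^ 2) := by
  have hA : (0 : ℝ) ≤ ∫ θ in (-π)..π, u θ ^ 2 :=
    intervalIntegral.integral_nonneg (by linarith [Real.pi_pos]) fun _ _ => sq_nonneg _
  have hB : (0 : ℝ) ≤ ∑' l, G l ^ 2 := tsum_nonneg fun _ => sq_nonneg _
  have hsplit : ∀ p : ℝ × ℤ, ‖((u p.1 * G p.2 : ℝ) : ℂ)‖ₑ ^ (2 : ℝ) =
      ENNReal.ofReal (u p.1 ^ 2) * ENNReal.ofReal (G p.2 ^ 2) := by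
    intro p
    rw [← ofReal_norm, Complex.norm_real, Real.norm_eq_abs,
      ENNReal.ofReal_rpow_of_nonneg (abs_nonneg _) (by norm_num),
      ← ENNReal.ofReal_mul (sq_nonneg _)]
    congr 1
    rw [Real.rpow_two, sq_abs, mul_pow]
  have hint : ∫⁻ θ in Set.Icc (-π) π, ENNReal.ofReal (u θ ^ 2) =
      ENNReal.ofReal (∫ θ in (-π)..π, u θ ^ 2) := by
    rw [intervalIntegral.integral_of_le (by linarith [Real.pi_pos]), ← integral_Icc_eq_integral_Ioc,
      ofReal_integral_eq_lintegral_ofReal]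
    · exact (Continuous.continuousOn (by fun_prop)).integrableOn_compact isCompact_Icc
    · exact Filter.Eventually.of_forall fun _ => sq_nonneg _
  have hcount : ∫⁻ l : ℤ, ENNReal.ofReal (G l ^ 2) ∂Measure.count =
      ENNReal.ofReal (∑' l, G l ^ 2) := by
    rw [lintegral_count, ENNReal.ofReal_tsum_of_nonneg (fun _ => sq_nonneg _) hG]
  rw [dataNorm, eLpNorm_eq_lintegral_rpow_enorm_toReal (by norm_num) (by norm_num)]
  simp only [ENNReal.toReal_ofNat, hsplit]
  rw [lintegral_prod_mul (f := fun θ => ENNReal.ofReal (u θ ^ 2))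
    (g := fun l => ENNReal.ofReal (G l ^ 2)) (by fun_prop) (measurable_of_countable _).aemeasurable,
    hint, hcount, ← ENNReal.ofReal_mul hA, ENNReal.ofReal_rpow_of_nonneg (by positivity)
      (by norm_num), ENNReal.toReal_ofReal (by positivity), Real.sqrt_eq_rpow]

lemma summable_sq_of_summable_abs {G : ℤ → ℝ} (hG : Summable fun l => |G l|) :
    (Summable fun l => G l ^ 2) ∧ ∑' l, G l ^ 2 ≤ (∑' l, |G l|) ^ 2 := by
  have hle : ∀ l, G l ^ 2 ≤ |G l| * ∑' n, |G n| := by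
    intro l
    rw [← sq_abs, sq]
    gcongr
    exact hG.le_tsum l fun j _ => abs_nonneg _
  have h1 := Summable.of_nonneg_of_le (fun l => sq_nonneg _) hle (hG.mul_right _)
  refine ⟨h1, (h1.tsum_le_tsum hle (hG.mul_right _)).trans (le_of_eq ?_)⟩
  rw [tsum_mul_right, sq]

lemma dataNorm_cos_mul_pos (k : ℤ) {G : ℤ → ℝ} (hG : Summable fun l => |G l|)
    (h : ∃ l, G l ≠ 0) : 0 < dataNorm (fun p => ((Real.cos (k * p.1) * G p.2 : ℝ) : ℂ)) := by
  obtain ⟨hs, -⟩ := summable_sq_of_summable_abs hG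
  rw [dataNorm_mul (u := fun θ => Real.cos (k * θ)) (by fun_prop) hs]
  obtain ⟨l, hl⟩ := h
  have h1 : 0 < ∑' l, G l ^ 2 := hs.tsum_pos (fun _ => sq_nonneg _) l (by positivity)
  have h2 : 0 < ∫ θ in (-π)..π, Real.cos (k * θ) ^ 2 := by
    refine intervalIntegral.integral_pos (by linarith [Real.pi_pos]) (by fun_prop)
      (fun _ _ => sq_nonneg _) ⟨0, ⟨by linarith [Real.pi_pos], Real.pi_pos.le⟩, by simp⟩
  positivity

lemma dataNorm_cos_mul_le (k : ℤ) {G : ℤ → ℝ} (hG : Summable fun l => |G l|) :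
    dataNorm (fun p => ((Real.cos (k * p.1) * G p.2 : ℝ) : ℂ)) ≤ 3 * ∑' l, |G l| := by
  obtain ⟨hs, hle⟩ := summable_sq_of_summable_abs hG
  rw [dataNorm_mul (u := fun θ => Real.cos (k * θ)) (by fun_prop) hs]
  -- The integral is at most `2π`; `9` is used as a perfect square, the source of the constant `3`.
  have h2 : ∫ θ in (-π)..π, Real.cos (k * θ) ^ 2 ≤ 9 := by
    have h := intervalIntegral.integral_mono_on (a := -π) (b := π) (μ := volume)
      (f := fun θ => Real.cos (k * θ) ^ 2) (g := fun _ => (1 : ℝ)) (by linarith [Real.pi_pos])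
      (Continuous.intervalIntegrable (by fun_prop) _ _) (by simp)
      (fun θ _ => Real.cos_sq_le_one _)
    have h3 := Real.pi_lt_d2
    simp only [intervalIntegral.integral_const, smul_eq_mul] at h
    linarith
  rw [Real.sqrt_le_left (by positivity)]
  calc (∫ θ in (-π)..π, Real.cos (k * θ) ^ 2) * ∑' l, G l ^ 2
      ≤ 9 * (∑' l, |G l|) ^ 2 := by gcongr
    _ = (3 * ∑' l, |G l|) ^ 2 := by ring

lemma T_add_sub (g : ℂ) (A B : L2Z →L[ℂ] L2Z) : T g (A + B) - T g A = T g B := by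
  funext p
  simp only [Pi.sub_apply, T, ContinuousLinearMap.add_comp, ContinuousLinearMap.comp_add, entry_add,
    add_sub_cancel_left]

lemma T_smul (g c : ℂ) (A : L2Z →L[ℂ] L2Z) (p : ℝ × ℤ) : T g (c • A) p = c * T g A p := by
  simp only [T, ContinuousLinearMap.smul_comp, ContinuousLinearMap.comp_smul, entry_smul]

lemma T_band (g : ℂ) (s : Finset ℤ) (w : ℤ → ℝ) (u v : ℤ) (θ : ℝ) (l : ℤ) :
    T g (band s w u v) (θ, l) = ∑ j ∈ s, (w j : ℂ) *
      (inner ℂ (e l) (U g θ (e (j + u))) * starRingEnd ℂ (inner ℂ (e l) (U g θ (e (j + v))))) := by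
  simp only [T, entry, band, ContinuousLinearMap.comp_apply, sum_apply, map_sum, inner_sum]
  refine Finset.sum_congr rfl fun j _ => ?_
  rw [smul_apply, InnerProductSpace.rankOne_apply, map_smul, map_smul,
    inner_smul_right, inner_smul_right, ContinuousLinearMap.adjoint_inner_right, inner_conj_symm]
  ring

/-- The two bands carry the conjugate phases `e^(±ikθ)` and the same real Bessel products, so the
variables `θ` and `l` separate and the second factor is a convolution. -/
lemma T_offDiag (g : ℂ) (s : Finset ℤ) (w : ℤ → ℝ) (k : ℤ) (θ : ℝ) (l : ℤ) :
    T g (offDiag s w k) (θ, l) =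
      ((Real.cos (k * θ) * (2 * ∑ j ∈ s, w j * besselProd (2 * ‖g‖) k (l - j)) : ℝ) : ℂ) := by
  have hadd : T g (offDiag s w k) (θ, l) = T g (band s w 0 k) (θ, l) + T g (band s w k 0) (θ, l) := by
    simp only [T, offDiag, ContinuousLinearMap.add_comp, ContinuousLinearMap.comp_add, entry_add]
  have hconj : ∀ a : ℤ, starRingEnd ℂ (Complex.exp (Complex.I * ((a : ℂ) * θ))) =
      Complex.exp (-(Complex.I * ((a : ℂ) * θ))) := by
    intro a
    rw [← Complex.exp_conj]
    congr 1
    simp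
  rw [hadd, T_band, T_band, ← Finset.sum_add_distrib, Finset.mul_sum, Finset.mul_sum,
    Complex.ofReal_sum]
  refine Finset.sum_congr rfl fun j _ => ?_
  simp only [inner_e_U_e, map_mul, hconj, Complex.conj_ofReal, add_zero, besselProd]
  have h1 : Complex.exp (Complex.I * (((l - j : ℤ) : ℂ) * θ)) *
      Complex.exp (-(Complex.I * (((l - (j + k) : ℤ) : ℂ) * θ))) =
      Complex.exp ((k * θ : ℂ) * Complex.I) := by
    rw [← Complex.exp_add]; congr 1; push_cast; ring
  have h2 : Complex.exp (Complex.I * (((l - (j + k) : ℤ) : ℂ) * θ)) *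
      Complex.exp (-(Complex.I * (((l - j : ℤ) : ℂ) * θ))) =
      Complex.exp (-(k * θ : ℂ) * Complex.I) := by
    rw [← Complex.exp_add]; congr 1; push_cast; ring
  have h3 := Complex.two_cos (k * θ : ℂ)
  rw [← h1, ← h2] at h3
  rw [show l - j - k = l - (j + k) by ring]
  push_cast at h3 ⊢
  linear_combination (-(w j : ℂ) * besselJ (l - j) (2 * ‖g‖) * besselJ (l - (j + k)) (2 * ‖g‖)) * h3

/-! ### The pair of states with box-power weights. -/

/-- The normalized weights of the construction. -/
def weight (M k : ℕ) (j : ℤ) : ℝ := boxPow M k j / (2 * (M : ℝ) ^ k)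

lemma hasSum_weight {M : ℕ} (hM : 0 < M) (k : ℕ) : HasSum (weight M k) (1 / 2) := by
  have h := (hasSum_boxPow M k).div_const (2 * (M : ℝ) ^ k)
  have hM' : (M : ℝ) ≠ 0 := by positivity
  convert! h using 1
  field_simp

lemma weight_eq_zero (M k : ℕ) (j : ℤ) (hj : j ∉ Finset.Icc (0 : ℤ) (k * M)) :
    weight M k j = 0 := by
  rw [weight, boxPow_eq_zero M k j hj, zero_div]

lemma weight_nonneg (M k : ℕ) (j : ℤ) : 0 ≤ weight M k j :=
  div_nonneg (boxPow_nonneg M k j) (by positivity)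

lemma T_smul_offDiag_weight (g : ℂ) (M k : ℕ) (β : ℝ) :
    T g ((β : ℂ) • offDiag (Finset.Icc (0 : ℤ) (k * M)) (weight M k) k) =
      fun p => ((Real.cos ((k : ℤ) * p.1) *
        (β / (M : ℝ) ^ k * (boxSum M)^[k] (besselProd (2 * ‖g‖) k) p.2) : ℝ) : ℂ) := by
  funext ⟨θ, l⟩
  have h := hasSum_boxPow_mul M k (besselProd (2 * ‖g‖) k) l
  have h2 : ∑ j ∈ Finset.Icc (0 : ℤ) (k * M), boxPow M k j * besselProd (2 * ‖g‖) k (l - j) =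
      (boxSum M)^[k] (besselProd (2 * ‖g‖) k) l := by
    rw [← h.tsum_eq, tsum_eq_sum fun j hj => by rw [boxPow_eq_zero M k j hj, zero_mul]]
  rw [T_smul, T_offDiag, ← Complex.ofReal_mul, ← h2]
  congr 1
  simp only [weight, Finset.mul_sum]
  refine Finset.sum_congr rfl fun j _ => ?_
  ring

/-- Two density operators that differ on the off-diagonals `±k` only. -/
theorem exists_density_pair {b : ℝ} (hb0 : 0 < b) (hb1 : b < 1) {g : ℂ} (hg : g ≠ 0)
    {M k : ℕ} (hM : 0 < M) (hk : 0 < k) :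
    ∃ ρ σ : L2Z →L[ℂ] L2Z, IsDensity ρ ∧ IsDensity σ ∧ HasExpDecay b 1 ρ ∧ HasExpDecay b 1 σ ∧
      0 < dataNorm (T g σ - T g ρ) ∧
      dataNorm (T g σ - T g ρ) ≤
        3 * ((∑' n, |besselJ n (2 * ‖g‖)|) ^ 2 * (2 * (2 * ‖g‖) * b / M) ^ k) ∧
      b ^ k / (2 * √(k * M + 1)) ≤ hsNorm (σ - ρ) := by
  have hx : 0 < 2 * ‖g‖ := by positivity
  have hM' : (0 : ℝ) < M := by exact_mod_cast hM
  have hk' : (k : ℤ) ≠ 0 := by exact_mod_cast hk.ne'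
  set s := Finset.Icc (0 : ℤ) (k * M)
  set w := weight M k
  have hs : ∀ j, j ∉ s → w j = 0 := weight_eq_zero M k
  have hw : ∀ j, 0 ≤ w j := weight_nonneg M k
  have hsum : HasSum w (1 / 2) := hasSum_weight hM k
  have hβ : b ^ k ≤ 1 := pow_le_one₀ hb0.le hb1.le
  -- The unperturbed state is the case `β = 0` of the same family.
  have hρ : diagState s w k = diagState s w k + ((0 : ℝ) : ℂ) • offDiag s w k := by simp
  obtain ⟨hsF, hF⟩ := boxSum_iterate_besselProd_le hx M k (k : ℤ) (le_abs_self _)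
  set F := (boxSum M)^[k] (besselProd (2 * ‖g‖) k)
  have hc : 0 < b ^ k / (M : ℝ) ^ k := by positivity
  have habs : ∀ l, |b ^ k / (M : ℝ) ^ k * F l| = b ^ k / (M : ℝ) ^ k * |F l| := fun l => by
    rw [abs_mul, abs_of_pos hc]
  have hsG : Summable fun l => |b ^ k / (M : ℝ) ^ k * F l| := by
    simpa only [habs] using hsF.mul_left _
  obtain ⟨G, hG⟩ : ∃ G : ℤ → ℝ, ∀ l, G l = b ^ k / (M : ℝ) ^ k * F l := ⟨_, fun _ => rfl⟩
  have hT : T g (((b ^ k : ℝ) : ℂ) • offDiag s w k) =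
      fun p => ((Real.cos ((k : ℤ) * p.1) * G p.2 : ℝ) : ℂ) := by
    simp only [hG]
    exact T_smul_offDiag_weight g M k (b ^ k)
  simp only [← hG] at hsG habs
  refine ⟨diagState s w k, diagState s w k + ((b ^ k : ℝ) : ℂ) • offDiag s w k, ?_, ?_, ?_, ?_, ?_,
    ?_, ?_⟩
  · rw [hρ]
    exact isDensity_diagState_add hs hw hsum hk' le_rfl zero_le_one
  · exact isDensity_diagState_add hs hw hsum hk' (by positivity) hβ
  · rw [hρ]
    exact hasExpDecay_diagState_add hs hw hsum hk' hb0.le le_rfl (by positivity)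
  · exact hasExpDecay_diagState_add hs hw hsum hk' hb0.le (by positivity) (by simp)
  · rw [T_add_sub, hT]
    obtain ⟨l, hl⟩ := exists_boxSum_iterate_besselProd_ne_zero hx hM k k
    exact dataNorm_cos_mul_pos _ hsG ⟨l, hG l ▸ mul_ne_zero hc.ne' hl⟩
  · rw [T_add_sub, hT]
    refine (dataNorm_cos_mul_le _ hsG).trans ?_
    refine mul_le_mul_of_nonneg_left ?_ zero_le_three
    rw [tsum_congr habs, tsum_mul_left]
    refine (mul_le_mul_of_nonneg_left hF hc.le).trans (le_of_eq ?_)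
    rw [div_pow, mul_pow _ b]
    ring
  · rw [add_sub_cancel_left]
    have := le_hsNorm_smul_offDiag hs hsum hk' (b ^ k)
    convert this using 4
    simp only [s, Int.card_Icc, sub_zero]
    have : (((k * M + 1 : ℤ).toNat : ℤ) : ℝ) = ((k * M + 1 : ℤ) : ℝ) := by
      rw [Int.toNat_of_nonneg (by positivity)]
    push_cast at this
    exact this.symm

/-! ### Comparison with `Φ` and choice of `k` and `M`. -/

/-- At `t = b^(2k²)` the square root in `Φ` equals `√2 k (-ln b)`, and `Φ` decreases in `t`. -/
lemma Φ_rpow_neg_le {b t α : ℝ} (hb0 : 0 < b) (hb1 : b < 1) (ht : 0 < t) (hα : 0 ≤ α) {k : ℕ}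
    (h : t ≤ b ^ (2 * k ^ 2)) : Φ b t ^ (-α) ≤ (b ^ k) ^ (√2 * α) := by
  have hβ : 0 < -Real.log b := neg_pos.2 (Real.log_neg hb0 hb1)
  have hlog : 2 * (k : ℝ) ^ 2 * (-Real.log b) ≤ -Real.log t := by
    have := Real.log_le_log ht h
    rw [Real.log_pow] at this
    push_cast at this
    linarith
  have hsq : √2 * k * (-Real.log b) ≤ √((-Real.log t) * (-Real.log b)) := by
    refine Real.le_sqrt_of_sq_le ?_
    rw [mul_pow, mul_pow, Real.sq_sqrt (by norm_num), sq (-Real.log b), ← mul_assoc]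
    gcongr
  rw [Φ, ← Real.exp_mul, Real.rpow_def_of_pos (by positivity), Real.exp_le_exp, Real.log_pow]
  nlinarith [mul_le_mul_of_nonneg_left hsq hα]

/-- The only place where `α > √2` is essential: it gives `√2 α > 2`, so `r = b^(√2 α - 2) < 1` and
`k r^k → 0`. -/
lemma exists_nat_mul_pow_le {b α : ℝ} (hb0 : 0 < b) (hb1 : b < 1) (hα : √2 < α) (A : ℝ) :
    ∃ k : ℕ, 0 < k ∧ A * k * (b ^ k) ^ (√2 * α) ≤ b ^ (2 * k) := by
  have h2 : 0 < √2 * α - 2 := by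
    have h := Real.mul_self_sqrt (show (0 : ℝ) ≤ 2 by norm_num)
    have h3 : 0 < √2 := by positivity
    nlinarith
  have hr1 : b ^ (√2 * α - 2) < 1 := Real.rpow_lt_one hb0.le hb1 h2
  have ht := (tendsto_self_mul_const_pow_of_lt_one (Real.rpow_nonneg hb0.le _) hr1).const_mul A
  rw [mul_zero] at ht
  obtain ⟨k, hk, hk0⟩ := ((ht.eventually (ge_mem_nhds zero_lt_one)).and
    (Filter.eventually_gt_atTop 0)).exists
  refine ⟨k, hk0, ?_⟩
  have h4 : (b ^ k) ^ (√2 * α) = (b ^ (√2 * α - 2)) ^ k * b ^ (2 * k) := by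
    rw [← Real.rpow_natCast, ← Real.rpow_natCast, ← Real.rpow_natCast, ← Real.rpow_mul hb0.le,
      ← Real.rpow_mul hb0.le, ← Real.rpow_add hb0]
    congr 1
    push_cast; ring
  rw [h4]
  have h5 := mul_le_mul_of_nonneg_right hk (pow_nonneg hb0.le (2 * k))
  linarith

end Pinem

end

theorem mainTheorem4 (b : ℝ) (hb0 : 0 < b) (hb1 : b < 1) :
    ∃ Ct : ℝ, 0 < Ct ∧
      ∀ (g : ℂ), g ≠ 0 → ∀ (α : ℝ), Real.sqrt 2 < α → ∀ (C : ℝ), 0 < C →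
        ∃ ρ σ : Pinem.L2Z →L[ℂ] Pinem.L2Z,
          Pinem.IsDensity ρ ∧ Pinem.IsDensity σ ∧
          Pinem.HasExpDecay b Ct ρ ∧ Pinem.HasExpDecay b Ct σ ∧
          0 < Pinem.dataNorm (Pinem.T g σ - Pinem.T g ρ) ∧
          Pinem.dataNorm (Pinem.T g σ - Pinem.T g ρ) < 1 ∧
          C * Pinem.Φ b (Pinem.dataNorm (Pinem.T g σ - Pinem.T g ρ)) ^ (-α)
            ≤ Pinem.hsNorm (σ - ρ) := by
  refine ⟨1, one_pos, fun g hg α hα C hC => ?_⟩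
  set K : ℝ := (∑' n, |Pinem.besselJ n (2 * ‖g‖)|) ^ 2 with hK
  have hK0 : 0 ≤ K := sq_nonneg _
  set x : ℝ := 2 * ‖g‖ with hx
  have hx0 : 0 < x := by positivity
  -- The factor `3K + 1`, raised to the power `k ≥ 1`, absorbs the prefactor `3K` of the data bound.
  -- The summand `1` gives `Q ≥ 1`, so rounding up to `M` at most doubles `Q / b^(2k)`.
  set Q : ℝ := 1 + 2 * x * (3 * K + 1) with hQ
  have hQ1 : 1 ≤ Q := by rw [hQ]; linarith [show 0 ≤ 2 * x * (3 * K + 1) by positivity]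
  -- `Q` does not depend on `k`; `4 Q k` is the denominator that the Hilbert–Schmidt lower bound
  -- will produce.
  obtain ⟨k, hk, hkb⟩ := Pinem.exists_nat_mul_pow_le hb0 hb1 hα (C * (4 * Q))
  have hB0 : 0 < b ^ (2 * k) := by positivity
  have hB1 : b ^ (2 * k) < 1 := pow_lt_one₀ hb0.le hb1 (by omega)
  have hQB : 1 ≤ Q / b ^ (2 * k) := by rw [le_div_iff₀ hB0]; linarith
  set M : ℕ := ⌈Q / b ^ (2 * k)⌉₊ with hM
  have hMl : Q / b ^ (2 * k) ≤ M := Nat.le_ceil _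
  have hMu : (M : ℝ) ≤ 2 * (Q / b ^ (2 * k)) := by
    have := Nat.ceil_lt_add_one (show 0 ≤ Q / b ^ (2 * k) by positivity)
    linarith
  have hM1 : (1 : ℝ) ≤ M := hQB.trans hMl
  have hM0 : 0 < M := by exact_mod_cast zero_lt_one.trans_le hM1
  have hk1 : (1 : ℝ) ≤ k := by exact_mod_cast hk
  obtain ⟨ρ, σ, h1, h2, h3, h4, h5, h6, h7⟩ := Pinem.exists_density_pair hb0 hb1 hg hM0 hk
  rw [← hx, ← hK] at h6
  set t := Pinem.dataNorm (Pinem.T g σ - Pinem.T g ρ) with ht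
  have ht1 : t ≤ b ^ (2 * k ^ 2) := by
    have hr : 2 * x * b / M ≤ b ^ (2 * k) / (3 * K + 1) := by
      rw [div_le_div_iff₀ (by linarith) (by positivity)]
      rw [div_le_iff₀ hB0] at hMl
      have : 2 * x * (3 * K + 1) * b ≤ 2 * x * (3 * K + 1) * 1 := by gcongr
      linarith
    have h8 : 3 * K ≤ (3 * K + 1) ^ k := by
      have := le_self_pow₀ (show 1 ≤ 3 * K + 1 by linarith) hk.ne'
      linarith
    calc t ≤ 3 * (K * (2 * x * b / M) ^ k) := h6
      _ ≤ 3 * (K * (b ^ (2 * k) / (3 * K + 1)) ^ k) := by gcongr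
      _ = 3 * K / (3 * K + 1) ^ k * b ^ (2 * k ^ 2) := by
        rw [div_pow, ← pow_mul, show 2 * k * k = 2 * k ^ 2 by ring]; ring
      _ ≤ 1 * b ^ (2 * k ^ 2) := by
        gcongr
        exact div_le_one_of_le₀ h8 (by positivity)
      _ = b ^ (2 * k ^ 2) := one_mul _
  refine ⟨ρ, σ, h1, h2, h3, h4, h5, ht1.trans_lt (pow_lt_one₀ hb0.le hb1 (by positivity)), ?_⟩
  have hα0 : 0 ≤ α := (Real.sqrt_nonneg 2).trans hα.le
  refine le_trans ?_ h7
  -- Here `kM + 1 ≤ 2kM ≤ 4kQ / b^(2k)`, and `k, Q ≥ 1` allow enlarging this to a perfect square.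
  have hroot : √(k * M + 1) ≤ 2 * k * Q / b ^ k := by
    rw [Real.sqrt_le_left (by positivity)]
    have e1 : (2 * k * Q / b ^ k) ^ 2 = 4 * k ^ 2 * Q * (Q / b ^ (2 * k)) := by
      rw [div_pow, ← pow_mul, mul_comm k 2]; ring
    rw [e1]
    calc (k : ℝ) * M + 1 ≤ k * M + k * M := by gcongr; nlinarith
      _ ≤ k * (2 * (Q / b ^ (2 * k))) + k * (2 * (Q / b ^ (2 * k))) := by gcongr
      _ = 4 * k * 1 * (Q / b ^ (2 * k)) := by ring
      _ ≤ 4 * (k * k) * Q * (Q / b ^ (2 * k)) := by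
        gcongr
        nlinarith
      _ = 4 * k ^ 2 * Q * (Q / b ^ (2 * k)) := by ring
  calc C * Pinem.Φ b t ^ (-α) ≤ C * (b ^ k) ^ (√2 * α) := by
        gcongr
        exact Pinem.Φ_rpow_neg_le hb0 hb1 h5 hα0 ht1
    _ ≤ b ^ (2 * k) / (4 * Q * k) := by
        rw [le_div_iff₀ (by positivity)]
        linarith
    _ = b ^ k / (2 * (2 * k * Q / b ^ k)) := by
        rw [mul_comm 2 k, pow_mul]
        field_simp
        norm_num
    _ ≤ b ^ k / (2 * √(k * M + 1)) := by gcongr
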